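/- All Banach spaces are complex. For a complex Hilbert space $H$ and a Banach space $E$, let $\gamma_\infty(H,E)$ be the space of almost summing operators, i.e. of all bounded linear operators $R:H\to E$ with $$\|R\|_{\gamma_\infty(H,E)}:=\sup\Big\|\sum_{n=1}^N\gamma_nRh_n\Big\|_{L^2(\Omega,E)}<\infty,$$ normed by this quantity, where $(\gamma_n)$ is a sequence of independent standard (real) Gaussian random variables on a probability space $\Omega$, and the supremum is over all $N$ and all finite orthonormal systems $h_1,\dots,h_N$ in $H$. A family $\mathcal T$ of bounded linear operators from $F$ to $E$ is called $R$-bounded if there is a constant $c\ge 0$ such that for all $N\ge1$, $T_1,\dots,T_N\in\mathcal T$ and $x_1,\dots,x_N\in F$, $$\mathbb E\Big\|\sum_{n=1}^N r_nT_nx_n\Big\|^2\le c^2\,\mathbb E\Big\|\sum_{n=1}^N r_nx_n\Big\|^2,$$ where $(r_n)$ is a sequence of independent random variables uniformly distributed on $\{-1,1\}$; the least such $c$ is the $R$-bound $\mathscr R(\mathcal T)$. For $\operatorname{Re}\lambda>0$ let $e_\lambda\in L^2(\mathbb R_+)$ be given by $e_\lambda(t)=e^{-\lambda t}$. The Laplace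 transform of a bounded linear operator $\Theta:F\to\gamma_\infty(L^2(\mathbb R_+),E)$ is the function $\widehat\Theta$, defined for $\operatorname{Re}\lambda>0$, whose values are the bounded linear operators $\widehat\Theta(\lambda):F\to E$, $\widehat\Theta(\lambda)y:=(\Theta y)(e_\lambda)$. **Theorem 3.1.** There is a universal constant $C>0$ with the following property. Let $E$ and $F$ be Banach spaces, let $\Theta:F\to\gamma_\infty(L^2(\mathbb R_+),E)$ be a bounded linear operator, and let $\delta>0$. Then the families $\{\widehat\Theta(\lambda):\operatorname{Re}\lambda>\delta\}$ and $\{\widehat\Theta(\lambda):\operatorname{Re}\lambda\ge\delta\}$ are $R$-bounded, and $$\mathscr R\big(\{\widehat\Theta(\lambda):\operatorname{Re}\lambda\ge\delta\}\big)\le\|\Theta\|\,\frac{C}{\sqrt\delta}.$$ -/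

import Mathlib

open MeasureTheory ProbabilityTheory
open scoped ENNReal

noncomputable section

/-! ### Almost summing operators -/

section AlmostSumming

variable {H E : Type*} [NormedAddCommGroup H] [InnerProductSpace ℂ H]
  [NormedAddCommGroup E] [NormedSpace ℂ E]

/-- The joint law on `ℝ^N` of `N` independent standard (real) Gaussian random variables. -/
def stdGaussianPi (N : ℕ) : Measure (Fin N → ℝ) :=
  Measure.pi fun _ => gaussianReal 0 1

instance (N : ℕ) : IsProbabilityMeasure (stdGaussianPi N) := by
  unfold stdGaussianPi; infer_instance

/-- The Gaussian sum `∑ γₙ xₙ`; the random variable `γₙ` is the `n`-th coordinate on `ℝ^N`. -/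
def gaussianSum {N : ℕ} (x : Fin N → E) (g : Fin N → ℝ) : E :=
  ∑ n, (g n : ℂ) • x n

/-- The extended norm `‖R‖_{γ_∞(H,E)} = sup ‖∑ γₙ R hₙ‖_{L²(Ω,E)}`, the supremum being taken over
all finite orthonormal systems in `H`. -/
def gammaENorm (R : H →L[ℂ] E) : ℝ≥0∞ :=
  ⨆ (N : ℕ) (h : Fin N → H) (_ : Orthonormal ℂ h),
    eLpNorm (gaussianSum fun n => R (h n)) 2 (stdGaussianPi N)

theorem continuous_gaussianSum {N : ℕ} (x : Fin N → E) : Continuous (gaussianSum x) := by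
  unfold gaussianSum; fun_prop

theorem gammaENorm_zero : gammaENorm (0 : H →L[ℂ] E) = 0 := by
  have h0 : ∀ N : ℕ, (gaussianSum fun _ : Fin N => (0 : E)) = 0 := by
    intro N; funext g; simp [gaussianSum]
  simp [gammaENorm, h0]

theorem gammaENorm_add_le (R S : H →L[ℂ] E) :
    gammaENorm (R + S) ≤ gammaENorm R + gammaENorm S := by
  refine iSup_le fun N => iSup_le fun h => iSup_le fun hh => ?_
  have key : (gaussianSum fun n => (R + S) (h n))
      = (gaussianSum fun n => R (h n)) + gaussianSum fun n => S (h n) := by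
    funext g; simp [gaussianSum, Finset.sum_add_distrib]
  rw [key]
  refine (eLpNorm_add_le (continuous_gaussianSum _).aestronglyMeasurable
    (continuous_gaussianSum _).aestronglyMeasurable (by norm_num)).trans ?_
  exact add_le_add
    (le_iSup_of_le N (le_iSup_of_le h (le_iSup_of_le hh le_rfl)))
    (le_iSup_of_le N (le_iSup_of_le h (le_iSup_of_le hh le_rfl)))

theorem gammaENorm_smul (c : ℂ) (R : H →L[ℂ] E) :
    gammaENorm (c • R) = ‖c‖ₑ * gammaENorm R := by
  simp only [gammaENorm, ENNReal.mul_iSup]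
  refine iSup_congr fun N => iSup_congr fun h => iSup_congr fun _ => ?_
  have key : (gaussianSum fun n => (c • R) (h n)) = c • gaussianSum fun n => R (h n) := by
    funext g; simp [gaussianSum, Finset.smul_sum, smul_comm c]
  rw [key, eLpNorm_const_smul]

theorem eLpNorm_id_gaussianReal : eLpNorm (fun x : ℝ => x) 2 (gaussianReal 0 1) = 1 := by
  have hm : MemLp (fun x : ℝ => x) 2 (gaussianReal 0 1) := memLp_id_gaussianReal 2
  have hv : ∫ x, x ^ 2 ∂(gaussianReal 0 1) = 1 := by
    have h1 := variance_of_integral_eq_zero (X := fun x : ℝ => x) (μ := gaussianReal 0 1)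
      measurable_id.aemeasurable (by simp)
    have h2 : Var[fun x : ℝ => x; gaussianReal 0 1] = 1 := by simp
    rw [← h1, h2]
  rw [hm.eLpNorm_eq_integral_rpow_norm (by norm_num) (by norm_num)]
  simp [hv]

theorem enorm_apply_le_gammaENorm (R : H →L[ℂ] E) (v : H) :
    ‖R v‖ₑ ≤ gammaENorm R * ‖v‖ₑ := by
  by_cases hv : v = 0
  · simp [hv]
  have hv' : (‖v‖ : ℂ) ≠ 0 := by simpa using hv
  set u : H := (‖v‖ : ℂ)⁻¹ • v with hu
  have hvu : v = (‖v‖ : ℂ) • u := by rw [hu, smul_smul, mul_inv_cancel₀ hv', one_smul]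
  have hun : ‖u‖ = 1 := by
    rw [hu, norm_smul]; simp [hv]
  have ho : Orthonormal ℂ (fun _ : Fin 1 => u) :=
    ⟨fun _ => hun, fun i j hij => (hij (Subsingleton.elim i j)).elim⟩
  have hle : ‖R u‖ₑ ≤ gammaENorm R := by
    refine le_trans ?_ (le_iSup_of_le 1 (le_iSup_of_le _ (le_iSup_of_le ho le_rfl)))
    have hmp : MeasurePreserving (Function.eval (0 : Fin 1)) (stdGaussianPi 1)
        (gaussianReal 0 1) := measurePreserving_eval (fun _ : Fin 1 => gaussianReal 0 1) 0
    have hs : eLpNorm (gaussianSum fun _ : Fin 1 => R u) 2 (stdGaussianPi 1)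
        = eLpNorm (fun x : ℝ => ‖R u‖ • x) 2 (gaussianReal 0 1) := by
      rw [← eLpNorm_comp_measurePreserving (by fun_prop) hmp]
      refine eLpNorm_congr_norm_ae (Filter.Eventually.of_forall fun g => ?_)
      simp [gaussianSum, norm_smul, mul_comm]
    rw [hs]
    have := eLpNorm_const_smul (‖R u‖) (fun x : ℝ => x) 2 (gaussianReal 0 1)
    rw [eLpNorm_id_gaussianReal, mul_one, enorm_norm] at this
    exact this.ge
  calc ‖R v‖ₑ = ‖R u‖ₑ * ‖v‖ₑ := by
        conv_lhs => rw [hvu, map_smul, enorm_smul]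
        rw [mul_comm]
        congr 1
        simp [enorm_eq_nnnorm, nnnorm, NNNorm.nnnorm]
    _ ≤ gammaENorm R * ‖v‖ₑ := by gcongr

variable (H E) in
/-- The linear space of almost summing operators, as a subspace of `B(H,E)`. -/
def almostSummingSubmodule : Submodule ℂ (H →L[ℂ] E) where
  carrier := {R | gammaENorm R < ∞}
  zero_mem' := by simp [gammaENorm_zero]
  add_mem' {R S} hR hS := (gammaENorm_add_le R S).trans_lt (ENNReal.add_lt_top.2 ⟨hR, hS⟩)
  smul_mem' c R hR := by
    change gammaENorm (c • R) < ∞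
    rw [gammaENorm_smul]
    exact ENNReal.mul_lt_top enorm_lt_top hR

variable (H E) in
/-- The space `γ_∞(H,E)` of almost summing operators. It is a type of its own because its norm is
not the operator norm. -/
def AlmostSumming : Type _ := almostSummingSubmodule H E

namespace AlmostSumming

instance : AddCommGroup (AlmostSumming H E) :=
  inferInstanceAs (AddCommGroup (almostSummingSubmodule H E))

instance : Module ℂ (AlmostSumming H E) :=
  inferInstanceAs (Module ℂ (almostSummingSubmodule H E))

variable (H E) in
/-- The inclusion of `γ_∞(H,E)` in `B(H,E)`, as a linear map. -/
def inclₗ : AlmostSumming H E →ₗ[ℂ] (H →L[ℂ] E) := (almostSummingSubmodule H E).subtype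

theorem gammaENorm_ne_top (R : AlmostSumming H E) : gammaENorm (inclₗ H E R) ≠ ∞ :=
  (show gammaENorm (inclₗ H E R) < ∞ from R.2).ne

instance : Norm (AlmostSumming H E) := ⟨fun R => (gammaENorm (inclₗ H E R)).toReal⟩

theorem norm_def (R : AlmostSumming H E) : ‖R‖ = (gammaENorm (inclₗ H E R)).toReal := rfl

theorem norm_apply_le (R : AlmostSumming H E) (v : H) : ‖inclₗ H E R v‖ ≤ ‖R‖ * ‖v‖ := by
  have h := enorm_apply_le_gammaENorm (inclₗ H E R) v
  have h' := ENNReal.toReal_mono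
    (ENNReal.mul_ne_top (gammaENorm_ne_top R) enorm_ne_top) h
  simpa [ENNReal.toReal_mul, norm_def] using h'

theorem normCore : NormedSpace.Core ℂ (AlmostSumming H E) where
  norm_nonneg R := ENNReal.toReal_nonneg
  norm_smul c R := by simp [norm_def, gammaENorm_smul]
  norm_triangle R S := by
    rw [norm_def, norm_def, norm_def, map_add,
      ← ENNReal.toReal_add (gammaENorm_ne_top R) (gammaENorm_ne_top S)]
    exact ENNReal.toReal_mono
      (ENNReal.add_ne_top.2 ⟨gammaENorm_ne_top R, gammaENorm_ne_top S⟩) (gammaENorm_add_le _ _)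
  norm_eq_zero_iff R := by
    constructor
    · intro h
      apply Subtype.ext
      ext v
      have := norm_apply_le R v
      rw [h, zero_mul] at this
      exact norm_le_zero_iff.1 this
    · rintro rfl
      simp [norm_def, gammaENorm_zero]

instance : NormedAddCommGroup (AlmostSumming H E) := NormedAddCommGroup.ofCore normCore

instance : NormedSpace ℂ (AlmostSumming H E) := NormedSpace.ofCore normCore

variable (H E) in
/-- The inclusion of `γ_∞(H,E)` in `B(H,E)`; it is contractive. -/
def incl : AlmostSumming H E →L[ℂ] (H →L[ℂ] E) :=
  (inclₗ H E).mkContinuous 1 fun R => by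
    rw [one_mul]
    exact ContinuousLinearMap.opNorm_le_bound _ (norm_nonneg R) (norm_apply_le R)

end AlmostSumming

end AlmostSumming

/-! ### `R`-boundedness -/

section RBounded

variable {F E : Type*} [NormedAddCommGroup F] [NormedSpace ℂ F]
  [NormedAddCommGroup E] [NormedSpace ℂ E]

/-- `𝔼‖∑ rₙ xₙ‖²` for independent Rademacher random variables `r₁, …, r_N`, whose joint law is the
uniform distribution on `{1,-1}^N`. -/
def rademacherSq {X : Type*} [NormedAddCommGroup X] {N : ℕ} (x : Fin N → X) : ℝ :=
  (∑ ε : Fin N → ℤˣ, ‖∑ n, ((ε n : ℤˣ) : ℤ) • x n‖ ^ 2) / 2 ^ N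

/-- `C` is an admissible constant in the definition of `R`-boundedness of the family `𝒯`. -/
def IsRBoundedWith (𝒯 : Set (F →L[ℂ] E)) (C : ℝ) : Prop :=
  ∀ (N : ℕ) (T : Fin N → F →L[ℂ] E) (x : Fin N → F), (∀ n, T n ∈ 𝒯) →
    rademacherSq (fun n => T n (x n)) ≤ C ^ 2 * rademacherSq x

/-- `R`-boundedness of a family of operators. -/
def IsRBounded (𝒯 : Set (F →L[ℂ] E)) : Prop := ∃ C : ℝ, 0 ≤ C ∧ IsRBoundedWith 𝒯 C

/-- The `R`-bound of an `R`-bounded family: its least admissible constant. -/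
def rBound (𝒯 : Set (F →L[ℂ] E)) : ℝ := sInf {C : ℝ | 0 ≤ C ∧ IsRBoundedWith 𝒯 C}

end RBounded

/-! ### Laplace transforms -/

section Laplace

/-- The complex Hilbert space `L²(ℝ₊)`. -/
abbrev L2Rplus : Type := Lp ℂ 2 (volume.restrict (Set.Ici (0 : ℝ)))

/-- The open right half-plane. -/
abbrev RightHalfPlane : Type := {z : ℂ // 0 < z.re}

theorem memLp_expFun (z : RightHalfPlane) :
    MemLp (fun t : ℝ => Complex.exp (-(z : ℂ) * t)) 2 (volume.restrict (Set.Ici (0 : ℝ))) := by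
  rw [memLp_two_iff_integrable_sq_norm (by fun_prop)]
  have h : (fun t : ℝ => ‖Complex.exp (-(z : ℂ) * t)‖ ^ 2)
      = fun t : ℝ => Real.exp (-(2 * (z : ℂ).re) * t) := by
    funext t
    rw [Complex.norm_exp, ← Real.exp_nat_mul]
    congr 1
    simp
    ring
  rw [h]
  change IntegrableOn _ _ _
  rw [integrableOn_Ici_iff_integrableOn_Ioi]
  exact exp_neg_integrableOn_Ioi 0 (by linarith [z.2])

/-- The element `e_z` of `L²(ℝ₊)`, `e_z(t) = exp (-z t)`. -/
def expL2 (z : RightHalfPlane) : L2Rplus := (memLp_expFun z).toLp _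

variable {F E : Type*} [NormedAddCommGroup F] [NormedSpace ℂ F]
  [NormedAddCommGroup E] [NormedSpace ℂ E]

/-- The Laplace transform `z ↦ T e_z` of a bounded operator `T : L²(ℝ₊) → E`. -/
def laplaceOp (T : L2Rplus →L[ℂ] E) (z : RightHalfPlane) : E := T (expL2 z)

/-- The Laplace transform of `Θ : F → B(L²(ℝ₊), E)`: at `z` it is the bounded operator from `F` to
`E` that sends `y` to the Laplace transform of `Θ y` at `z`. -/
def laplaceTransform (Θ : F →L[ℂ] (L2Rplus →L[ℂ] E)) (z : RightHalfPlane) : F →L[ℂ] E :=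
  LinearMap.mkContinuous
    { toFun := fun y => laplaceOp (Θ y) z
      map_add' := fun x y => by simp [laplaceOp]
      map_smul' := fun c y => by simp [laplaceOp] }
    (‖Θ‖ * ‖expL2 z‖) fun y => by
      have h := (Θ y).le_of_opNorm_le (Θ.le_opNorm y) (expL2 z)
      simp only [LinearMap.coe_mk, AddHom.coe_mk, laplaceOp]
      linarith

end Laplace

end

/-! The set of operators `Θ̂(λ)` with `Re λ ≥ δ` is obtained from a countable `R`-bounded family by
series with uniformly absolutely summable coefficients.

The countable family consists of the operators `y ↦ (Θ y) h` with `h` in an orthonormal system. For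
such operators, a Rademacher sum is dominated by a sum with extra Gaussian factors (Jensen, at the
cost of the first absolute moment of a Gaussian). That sum is dominated by the full Gaussian double
sum over all `h`, since averaging over sign changes of the Gaussians removes the off-diagonal terms.
Linearity of `Θ` and the definition of the `γ_∞` norm bound the double sum. This is
`isRBoundedWith_orthonormal`. Absolutely convex combinations and limits cost only a factor 2, for
real and imaginary parts (`IsRBoundedWith.of_hasSum`).

It remains to expand `e_λ`. With `L = π/δ`, cut the half-line into windows of length `L`. An
ordinary Fourier series on a window sees a jump, so its coefficients are not absolutely summable.
The even `2L`-periodic extension is continuous, and its coefficients decay quadratically. The price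
is frequencies `πk/L`, which are not orthogonal on a window; but those with `k` of one parity are,
so two orthonormal systems suffice. Large imaginary parts of `λ` are absorbed beforehand by a shift
of the frequency index, and the windows contribute a geometric factor. Hence the coefficients have
`ℓ¹` norm at most a constant times `√L`, uniformly in `λ` (`exists_hasSum_windowExp`), which gives
the rate `1/√δ`. -/

noncomputable section

/-! ### Elementary properties of Rademacher averages -/

section RademacherAverages

variable {X : Type*} [NormedAddCommGroup X] {N : ℕ}

theorem rademacherSq_nonneg (x : Fin N → X) : 0 ≤ rademacherSq x := by
  unfold rademacherSq; positivity

/-- Multiplication by a fixed sign vector permutes all sign vectors. -/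
theorem rademacherSq_units_smul (s : Fin N → ℤˣ) (x : Fin N → X) :
    rademacherSq (fun n => ((s n : ℤˣ) : ℤ) • x n) = rademacherSq x := by
  unfold rademacherSq
  congr 1
  refine Fintype.sum_equiv (Equiv.mulRight s) _ _ fun ε => ?_
  simp [mul_smul]

theorem rademacherSq_smul {𝕜 : Type*} [NormedField 𝕜] [NormedSpace 𝕜 X] (c : 𝕜) (x : Fin N → X) :
    rademacherSq (fun n => c • x n) = ‖c‖ ^ 2 * rademacherSq x := by
  unfold rademacherSq
  rw [← mul_div_assoc, Finset.mul_sum]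
  congr 1
  refine Finset.sum_congr rfl fun ε _ => ?_
  rw [← mul_pow, ← norm_smul, Finset.smul_sum]
  simp only [smul_comm c]

theorem rademacherSq_const_one (x : X) : rademacherSq (fun _ : Fin 1 => x) = ‖x‖ ^ 2 := by
  have : ∀ ε : Fin 1 → ℤˣ, ‖((ε 0 : ℤˣ) : ℤ) • x‖ = ‖x‖ := by
    intro ε
    rcases Int.units_eq_one_or (ε 0) with h | h <;> simp [h]
  simp [rademacherSq, this]

theorem rademacherSq_add_le (x y : Fin N → X) :
    rademacherSq (fun n => x n + y n) ≤ 2 * rademacherSq x + 2 * rademacherSq y := by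
  unfold rademacherSq
  rw [← mul_div_assoc, ← mul_div_assoc, ← add_div, Finset.mul_sum, Finset.mul_sum,
    ← Finset.sum_add_distrib]
  gcongr with ε
  simp only [smul_add, Finset.sum_add_distrib]
  set U := ∑ n, ((ε n : ℤˣ) : ℤ) • x n
  set V := ∑ n, ((ε n : ℤˣ) : ℤ) • y n
  have h1 := norm_add_le U V
  have h2 := norm_nonneg (U + V)
  nlinarith [sq_nonneg (‖U‖ - ‖V‖)]

theorem rademacherSq_convex_le [NormedSpace ℝ X] (x y : Fin N → X) {a b : ℝ} (ha : 0 ≤ a)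
    (hb : 0 ≤ b) (hab : a + b = 1) :
    rademacherSq (fun n => a • x n + b • y n) ≤ a * rademacherSq x + b * rademacherSq y := by
  unfold rademacherSq
  rw [← mul_div_assoc, ← mul_div_assoc, ← add_div, Finset.mul_sum, Finset.mul_sum,
    ← Finset.sum_add_distrib]
  gcongr with ε
  simp only [smul_add, Finset.sum_add_distrib, smul_comm _ a, smul_comm _ b, ← Finset.smul_sum]
  set U := ∑ n, ((ε n : ℤˣ) : ℤ) • x n
  set V := ∑ n, ((ε n : ℤˣ) : ℤ) • y n
  have h1 := norm_add_le (a • U) (b • V)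
  rw [norm_smul, norm_smul, Real.norm_of_nonneg ha, Real.norm_of_nonneg hb] at h1
  have h2 := norm_nonneg (a • U + b • V)
  obtain rfl : b = 1 - a := by linarith
  have h3 : ‖a • U + (1 - a) • V‖ ^ 2 ≤ (a * ‖U‖ + (1 - a) * ‖V‖) ^ 2 := by gcongr
  nlinarith [mul_nonneg (mul_nonneg ha hb) (sq_nonneg (‖U‖ - ‖V‖))]

end RademacherAverages

/-! ### Stability of `R`-bounds under hulls, series and unions -/

section RBounds

variable {F E : Type*} [NormedAddCommGroup F] [NormedSpace ℂ F]
  [NormedAddCommGroup E] [NormedSpace ℂ E] {𝒯 𝒮 : Set (F →L[ℂ] E)} {C : ℝ}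

theorem IsRBoundedWith.mono (h : IsRBoundedWith 𝒯 C) (hs : 𝒮 ⊆ 𝒯) : IsRBoundedWith 𝒮 C :=
  fun N T x hT => h N T x fun n => hs (hT n)

theorem IsRBoundedWith.smul (h : IsRBoundedWith 𝒯 C) (c : ℂ) :
    IsRBoundedWith {T | ∃ S ∈ 𝒯, T = c • S} (‖c‖ * C) := by
  intro N T x hT
  choose S hS hTS using hT
  have : (fun n => T n (x n)) = fun n => c • S n (x n) := by
    funext n; simp [hTS]
  rw [this, rademacherSq_smul, mul_pow, mul_assoc]
  gcongr
  exact h N S x hS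

theorem IsRBoundedWith.add (h : IsRBoundedWith 𝒯 C) (h' : IsRBoundedWith 𝒮 C) :
    IsRBoundedWith {T | ∃ U ∈ 𝒯, ∃ V ∈ 𝒮, T = U + V} (2 * C) := by
  intro N T x hT
  choose U hU V hV hTUV using hT
  have : (fun n => T n (x n)) = fun n => U n (x n) + V n (x n) := by
    funext n; simp [hTUV]
  rw [this]
  have h1 := h N U x hU
  have h2 := h' N V x hV
  have h3 := rademacherSq_add_le (fun n => U n (x n)) (fun n => V n (x n))
  nlinarith

theorem IsRBoundedWith.union_neg (h : IsRBoundedWith 𝒯 C) :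
    IsRBoundedWith {T | T ∈ 𝒯 ∨ -T ∈ 𝒯} C := by
  intro N T x hT
  have : ∀ n, ∃ s : ℤˣ, ((s : ℤ) • T n) ∈ 𝒯 := by
    intro n
    rcases hT n with h | h
    · exact ⟨1, by simpa using h⟩
    · exact ⟨-1, by simpa using h⟩
  choose s hs using this
  have h1 := h N (fun n => ((s n : ℤˣ) : ℤ) • T n) x hs
  have h2 : (fun n => (((s n : ℤˣ) : ℤ) • T n) (x n))
      = fun n => ((s n : ℤˣ) : ℤ) • T n (x n) := by
    funext n
    rcases Int.units_eq_one_or (s n) with h | h <;> simp [h]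
  rwa [h2, rademacherSq_units_smul] at h1

/-- With all other slots frozen, the operators admissible in one slot form a closed convex set,
because the average is a continuous convex function of that operator. The slots are therefore moved
from `𝒯` to the hull one at a time, by induction on the set of slots already moved. -/
theorem IsRBoundedWith.closedConvexHull (h : IsRBoundedWith 𝒯 C) :
    IsRBoundedWith (closedConvexHull ℝ 𝒯) C := by
  intro N T x hT
  suffices H : ∀ (s : Finset (Fin N)) (T : Fin N → F →L[ℂ] E),
      (∀ n ∈ s, T n ∈ _root_.closedConvexHull ℝ 𝒯) → (∀ n ∉ s, T n ∈ 𝒯) →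
      rademacherSq (fun n => T n (x n)) ≤ C ^ 2 * rademacherSq x from
    H Finset.univ T (fun n _ => hT n) (by simp)
  intro s
  induction s using Finset.induction with
  | empty => exact fun T _ hT => h N T x fun n => hT n (by simp)
  | insert n s hn ih =>
    intro T hT1 hT2
    let K : Set (F →L[ℂ] E) := {S | rademacherSq (fun m => Function.update T n S m (x m))
      ≤ C ^ 2 * rademacherSq x}
    have hK : _root_.closedConvexHull ℝ 𝒯 ⊆ K := by
      refine closedConvexHull_min ?_ ?_ ?_
      · intro S hS
        refine ih _ ?_ ?_
        · intro m hm
          rw [Function.update_of_ne (by rintro rfl; exact hn hm)]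
          exact hT1 m (Finset.mem_insert_of_mem hm)
        · intro m hm
          by_cases hmn : m = n
          · subst hmn; simpa using hS
          · rw [Function.update_of_ne hmn]
            exact hT2 m (by simp [hmn, hm])
      · intro S hS S' hS' a b ha hb hab
        have e : (fun m => Function.update T n (a • S + b • S') m (x m))
            = fun m => a • Function.update T n S m (x m) + b • Function.update T n S' m (x m) := by
          funext m
          by_cases hmn : m = n
          · subst hmn; simp
          · simp [hmn, ← add_smul, hab]
        change rademacherSq _ ≤ _
        rw [e]
        refine (rademacherSq_convex_le _ _ ha hb hab).trans ?_
        have h1 := mul_le_mul_of_nonneg_left hS ha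
        have h2 := mul_le_mul_of_nonneg_left hS' hb
        have h3 : C ^ 2 * rademacherSq x
          = a * (C ^ 2 * rademacherSq x) + b * (C ^ 2 * rademacherSq x) := by
          rw [← add_mul, hab, one_mul]
        rw [h3]
        exact add_le_add h1 h2
      · refine isClosed_le ?_ continuous_const
        unfold rademacherSq
        have : ∀ m, Continuous fun S : F →L[ℂ] E => Function.update T n S m (x m) := by
          intro m
          by_cases hmn : m = n
          · subst hmn; simp only [Function.update_self]; fun_prop
          · simp only [Function.update_of_ne hmn]; fun_prop
        fun_prop
    have := hK (hT1 n (Finset.mem_insert_self _ _))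
    simpa [K] using this

/-- Partial sums lie in `A` times the closed convex hull of the `±S i`, and closed hulls keep the
constant. -/
theorem IsRBoundedWith.of_hasSum_real {ι : Type*} {S : ι → F →L[ℂ] E} {A : ℝ}
    (h : IsRBoundedWith (Set.range S) C) :
    IsRBoundedWith {T | ∃ a : ι → ℝ, (∀ s : Finset ι, ∑ i ∈ s, |a i| ≤ A) ∧
      HasSum (fun i => (a i : ℂ) • S i) T} (A * C) := by
  rcases isEmpty_or_nonempty ι with hι | ⟨⟨i₀⟩⟩
  · intro N T x hT
    have : (fun n => T n (x n)) = fun _ => (0 : E) := by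
      funext n
      obtain ⟨a, -, ha⟩ := hT n
      rw [ha.unique (hasSum_empty)]; simp
    rw [this]
    have h0 := rademacherSq_nonneg x
    simp only [rademacherSq, smul_zero, Finset.sum_const_zero, norm_zero]
    simp
    rw [← rademacherSq]
    positivity
  -- For negative `A` the family is empty, since the empty partial sum already violates the bound;
  -- only `N = 0` is left.
  rcases lt_or_ge A 0 with hA | hA
  · rintro N T x hT
    rcases N with _ | N
    · have := rademacherSq_nonneg x
      simp [rademacherSq]
    · obtain ⟨a, ha, -⟩ := hT 0
      exact absurd (ha ∅) (by simpa using hA)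
  set K := _root_.closedConvexHull ℝ {T | T ∈ Set.range S ∨ -T ∈ Set.range S} with hKdef
  have hKc : Convex ℝ K := convex_closedConvexHull
  have hS : ∀ i, S i ∈ K := fun i => subset_closedConvexHull (Or.inl ⟨i, rfl⟩)
  have hS' : ∀ i, -S i ∈ K := fun i => subset_closedConvexHull (Or.inr ⟨i, by simp⟩)
  have h0 : (0 : F →L[ℂ] E) ∈ K := by
    have := hKc (hS i₀) (hS' i₀) (by norm_num : (0 : ℝ) ≤ 1 / 2) (by norm_num : (0 : ℝ) ≤ 1 / 2)
      (by norm_num)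
    simpa using this
  have hK : IsRBoundedWith K C := h.union_neg.closedConvexHull
  have hfin : ∀ (a : ι → ℝ) (s : Finset ι), ∑ i ∈ s, |a i| ≤ A →
      ∃ R ∈ K, ∑ i ∈ s, (a i : ℂ) • S i = (A : ℂ) • R := by
    intro a s hs
    have hpos : 0 ≤ ∑ i ∈ s, |a i| := Finset.sum_nonneg fun _ _ => abs_nonneg _
    rcases hpos.eq_or_lt with h | hpos
    · refine ⟨0, h0, ?_⟩
      rw [smul_zero]
      refine Finset.sum_eq_zero fun i hi => ?_
      have := (Finset.sum_eq_zero_iff_of_nonneg fun i _ => abs_nonneg (a i)).1 h.symm i hi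
      rw [abs_eq_zero] at this
      simp [this]
    have hA' : 0 < A := hpos.trans_le hs
    have hmem := hKc.centerMass_mem (t := s) (w := fun i => |a i|)
      (z := fun i => if 0 ≤ a i then S i else -S i) (fun i _ => abs_nonneg _) hpos (by
        intro i _
        split_ifs
        · exact hS i
        · exact hS' i)
    have hsum : ∑ i ∈ s, |a i| • (if 0 ≤ a i then S i else -S i) = ∑ i ∈ s, (a i : ℂ) • S i := by
      refine Finset.sum_congr rfl fun i _ => ?_
      split_ifs with hi
      · rw [abs_of_nonneg hi]; rfl
      · rw [abs_of_neg (not_le.1 hi), neg_smul_neg]; rfl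
    rw [Finset.centerMass, hsum] at hmem
    -- The total weight may be smaller than `A`; the hull contains `0`, so the centre of mass can be
    -- scaled down.
    refine ⟨_, hKc.smul_mem_of_zero_mem h0 hmem (t := (∑ i ∈ s, |a i|) / A)
      ⟨by positivity, (div_le_one hA').2 hs⟩, ?_⟩
    rw [smul_smul, div_mul_eq_mul_div, mul_inv_cancel₀ hpos.ne', ← Complex.coe_smul, smul_smul]
    push_cast
    rw [mul_one_div_cancel (by exact_mod_cast hA'.ne'), one_smul]
  have hAK := hK.smul (A : ℂ)
  rw [Complex.norm_of_nonneg hA] at hAK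
  -- A second closed hull absorbs the limit of the partial sums.
  refine hAK.closedConvexHull.mono ?_
  rintro T ⟨a, ha, hT⟩
  refine isClosed_closedConvexHull.mem_of_tendsto hT (Filter.Eventually.of_forall fun s => ?_)
  exact subset_closedConvexHull (hfin a s (ha s))

theorem IsRBoundedWith.norm_le (h : IsRBoundedWith 𝒯 C) (hC : 0 ≤ C) {T : F →L[ℂ] E}
    (hT : T ∈ 𝒯) : ‖T‖ ≤ C := by
  refine T.opNorm_le_bound hC fun y => ?_
  have h1 := h 1 (fun _ => T) (fun _ => y) fun _ => hT
  rw [rademacherSq_const_one, rademacherSq_const_one, ← mul_pow] at h1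
  exact le_of_sq_le_sq h1 (by positivity)

/-- Real and imaginary parts of the coefficients are treated separately, whence the factor 2.
Completeness makes the two series of parts converge. -/
theorem IsRBoundedWith.of_hasSum [CompleteSpace E] {ι : Type*} {S : ι → F →L[ℂ] E} {A : ℝ}
    (h : IsRBoundedWith (Set.range S) C) (hC : 0 ≤ C) :
    IsRBoundedWith {T | ∃ a : ι → ℂ, (∀ s : Finset ι, ∑ i ∈ s, ‖a i‖ ≤ A) ∧
      HasSum (fun i => a i • S i) T} (2 * (A * C)) := by
  have hre := h.of_hasSum_real (A := A)
  have him := hre.smul Complex.I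
  rw [Complex.norm_I, one_mul] at him
  refine (hre.add him).mono ?_
  rintro T ⟨a, ha, hT⟩
  have hsum : Summable fun i => ‖a i‖ * C :=
    (summable_of_sum_le (fun i => norm_nonneg _) ha).mul_right C
  have key : ∀ b : ι → ℝ, (∀ i, |b i| ≤ ‖a i‖) → ∃ U : F →L[ℂ] E,
      (∀ s : Finset ι, ∑ i ∈ s, |b i| ≤ A) ∧ HasSum (fun i => (b i : ℂ) • S i) U := by
    intro b hb
    refine ⟨_, fun s => (Finset.sum_le_sum fun i _ => hb i).trans (ha s),
      (Summable.of_norm_bounded hsum fun i => ?_).hasSum⟩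
    rw [norm_smul, Complex.norm_real]
    exact mul_le_mul (hb i) (h.norm_le hC ⟨i, rfl⟩) (norm_nonneg _) (norm_nonneg _)
  obtain ⟨U, hU, hU'⟩ := key (fun i => (a i).re) fun i => Complex.abs_re_le_norm _
  obtain ⟨V, hV, hV'⟩ := key (fun i => (a i).im) fun i => Complex.abs_im_le_norm _
  refine ⟨U, ⟨_, hU, hU'⟩, Complex.I • V, ⟨V, ⟨_, hV, hV'⟩, rfl⟩, hT.unique ?_⟩
  convert hU'.add (hV'.const_smul Complex.I) using 2 with i
  rw [smul_smul, ← add_smul, mul_comm Complex.I, Complex.re_add_im]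

/-- Both `0` and the members of `𝒯` are series with coefficient sum at most 1. With `0` available, a
union embeds in a sum of families. -/
theorem IsRBoundedWith.insert_zero (h : IsRBoundedWith 𝒯 C) :
    IsRBoundedWith (insert 0 𝒯) C := by
  have := IsRBoundedWith.of_hasSum_real (S := fun i : 𝒯 => (i : F →L[ℂ] E)) (A := 1) (C := C)
    (by simpa using h)
  rw [one_mul] at this
  refine this.mono ?_
  rintro T (rfl | hT)
  · exact ⟨0, by simp, by simp⟩
  · classical
    refine ⟨Pi.single ⟨T, hT⟩ 1, fun s => ?_, ?_⟩
    · have : ∀ i : 𝒯, |(Pi.single ⟨T, hT⟩ (1 : ℝ) : 𝒯 → ℝ) i| = if i = ⟨T, hT⟩ then 1 else 0 := by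
        intro i
        by_cases hi : i = ⟨T, hT⟩ <;> simp [hi]
      simp only [this, Finset.sum_ite_eq']
      split_ifs <;> norm_num
    · convert hasSum_single (⟨T, hT⟩ : 𝒯) _ using 1
      · simp
      · intro i hi
        simp [hi]

theorem IsRBoundedWith.union (h : IsRBoundedWith 𝒯 C) (h' : IsRBoundedWith 𝒮 C) :
    IsRBoundedWith (𝒯 ∪ 𝒮) (2 * C) := by
  refine (h.insert_zero.add h'.insert_zero).mono ?_
  rintro T (hT | hT)
  · exact ⟨T, Or.inr hT, 0, Or.inl rfl, by simp⟩
  · exact ⟨0, Or.inl rfl, T, Or.inr hT, by simp⟩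

end RBounds

/-! ### Comparison of Gaussian and Rademacher sums -/

section SignAverages

variable {E : Type*} [NormedAddCommGroup E] [NormedSpace ℂ E]

/-- The first absolute moment of a standard Gaussian random variable. -/
def gaussianAbsMoment : ℝ := ∫ x, |x| ∂(gaussianReal 0 1)

theorem integrable_abs_gaussianReal : Integrable (fun x : ℝ => |x|) (gaussianReal 0 1) :=
  ((memLp_id_gaussianReal 1).integrable (by norm_num)).abs

theorem gaussianAbsMoment_pos : 0 < gaussianAbsMoment := by
  refine (integral_nonneg fun x => abs_nonneg x).lt_of_ne fun h => ?_
  have h1 := (integral_eq_zero_iff_of_nonneg (fun x => abs_nonneg x)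
    integrable_abs_gaussianReal).1 h.symm
  have h2 : eLpNorm (fun x : ℝ => x) 2 (gaussianReal 0 1) = 0 := by
    rw [eLpNorm_eq_zero_iff (by fun_prop) (by norm_num)]
    filter_upwards [h1] with x hx
    simpa using hx
  rw [eLpNorm_id_gaussianReal] at h2
  exact one_ne_zero h2

theorem integral_abs_eval_stdGaussianPi {M : ℕ} (m : Fin M) :
    ∫ g, |g m| ∂(stdGaussianPi M) = gaussianAbsMoment := by
  have hmp : MeasurePreserving (Function.eval m) (stdGaussianPi M) (gaussianReal 0 1) :=
    measurePreserving_eval (fun _ : Fin M => gaussianReal 0 1) m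
  have := integral_map (μ := stdGaussianPi M) hmp.measurable.aemeasurable
    (f := fun x : ℝ => |x|) (by fun_prop)
  rw [hmp.map_eq] at this
  exact this.symm

/-- The standard Gaussian law is invariant under sign changes of the coordinates. -/
theorem measurePreserving_units_mul {M : ℕ} (s : Fin M → ℤˣ) :
    MeasurePreserving (fun (g : Fin M → ℝ) m => (((s m : ℤˣ) : ℤ) : ℝ) * g m)
      (stdGaussianPi M) (stdGaussianPi M) := by
  refine measurePreserving_pi (f := fun m x => (((s m : ℤˣ) : ℤ) : ℝ) * x) _ _ fun m => ?_
  refine ⟨by fun_prop, ?_⟩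
  rcases Int.units_eq_one_or (s m) with h | h
  · simp only [h, Units.val_one, Int.cast_one, one_mul]
    exact Measure.map_id
  · have := gaussianReal_map_neg (μ := 0) (v := 1)
    simpa [h, -neg_mul, neg_one_mul] using this

theorem sum_units_mul_units {M : ℕ} (m m' : Fin M) :
    ∑ s : Fin M → ℤˣ, (((s m : ℤˣ) : ℤ) * ((s m' : ℤˣ) : ℤ)) = if m = m' then 2 ^ M else 0 := by
  split_ifs with h
  · subst h
    have : ∀ s : Fin M → ℤˣ, (((s m : ℤˣ) : ℤ) * ((s m : ℤˣ) : ℤ)) = 1 := fun s => by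
      rw [← Units.val_mul, Int.units_mul_self]; rfl
    simp [this]
  -- Flipping the single sign at `m` negates every term, so the sum equals its own negative.
  · set σ : Equiv.Perm (Fin M → ℤˣ) := Equiv.mulRight (Pi.mulSingle m (-1))
    have h1 := Equiv.sum_comp σ fun s => (((s m : ℤˣ) : ℤ) * ((s m' : ℤˣ) : ℤ))
    have h2 : ∀ s, ((((σ s) m : ℤˣ) : ℤ) * (((σ s) m' : ℤˣ) : ℤ))
        = -(((s m : ℤˣ) : ℤ) * ((s m' : ℤˣ) : ℤ)) := by
      intro s
      simp [σ, Ne.symm h]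
    simp only [h2, Finset.sum_neg_distrib] at h1
    omega

theorem norm_sum_sq_le {ι X : Type*} [Fintype ι] [NormedAddCommGroup X] (w : ι → X) :
    ‖∑ i, w i‖ ^ 2 ≤ Fintype.card ι * ∑ i, ‖w i‖ ^ 2 := by
  calc ‖∑ i, w i‖ ^ 2 ≤ (∑ i, ‖w i‖) ^ 2 := by gcongr; exact norm_sum_le _ _
    _ ≤ _ := sq_sum_le_card_mul_sum_sq

/-- This is Jensen's inequality, read off from the nonnegative variance of `‖f‖`. -/
theorem sq_norm_integral_le {Ω : Type*} {mΩ : MeasurableSpace Ω} {μ : Measure Ω}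
    [IsProbabilityMeasure μ] {f : Ω → E} (hf : MemLp f 2 μ) :
    ‖∫ ω, f ω ∂μ‖ ^ 2 ≤ ∫ ω, ‖f ω‖ ^ 2 ∂μ := by
  have h1 := norm_integral_le_integral_norm (μ := μ) f
  have h2 := variance_nonneg (fun ω => ‖f ω‖) μ
  rw [variance_eq_sub hf.norm] at h2
  have h3 : ‖∫ ω, f ω ∂μ‖ ^ 2 ≤ (∫ ω, ‖f ω‖ ∂μ) ^ 2 := by gcongr
  refine h3.trans ?_
  simpa using h2

theorem memLp_eval_smul {M : ℕ} (m : Fin M) (e : E) :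
    MemLp (fun g : Fin M → ℝ => (g m : ℂ) • e) 2 (stdGaussianPi M) := by
  have h1 : MemLp (fun x : ℝ => x) 2 (gaussianReal 0 1) := memLp_id_gaussianReal 2
  have h2 := h1.comp_measurePreserving
    (measurePreserving_eval (fun _ : Fin M => gaussianReal 0 1) m)
  refine (h2.norm.mul_const ‖e‖).congr_norm
    (Continuous.aestronglyMeasurable (by fun_prop)) (Filter.Eventually.of_forall fun g => ?_)
  simp [norm_smul]

theorem memLp_abs_eval_smul {M : ℕ} (m : Fin M) (e : E) :
    MemLp (fun g : Fin M → ℝ => ((|g m| : ℝ) : ℂ) • e) 2 (stdGaussianPi M) := by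
  refine (memLp_eval_smul m e).congr_norm
    (Continuous.aestronglyMeasurable (by fun_prop)) (Filter.Eventually.of_forall fun g => ?_)
  simp [norm_smul]

theorem memLp_gaussianSum {M : ℕ} (x : Fin M → E) :
    MemLp (gaussianSum x) 2 (stdGaussianPi M) :=
  memLp_finsetSum _ fun m _ => memLp_eval_smul m (x m)

theorem MeasureTheory.MemLp.integrable_sq_norm {Ω X : Type*} {mΩ : MeasurableSpace Ω}
    {μ : Measure Ω} [NormedAddCommGroup X] {f : Ω → X}
    (hf : MemLp f 2 μ) : Integrable (fun ω => ‖f ω‖ ^ 2) μ :=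
  (memLp_two_iff_integrable_sq_norm hf.1).1 hf

theorem rademacherSq_abs_smul {N : ℕ} (a : Fin N → ℝ) (v : Fin N → E) :
    rademacherSq (fun n => ((|a n| : ℝ) : ℂ) • v n) = rademacherSq (fun n => (a n : ℂ) • v n) := by
  rw [← rademacherSq_units_smul (fun n => if 0 ≤ a n then 1 else -1)]
  congr 1
  funext n
  split_ifs with h
  · simp [abs_of_nonneg h]
  · simp [abs_of_neg (not_le.1 h)]

theorem integrable_rademacherSq {Ω : Type*} {mΩ : MeasurableSpace Ω} {μ : Measure Ω} {N : ℕ}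
    {X : Type*} [NormedAddCommGroup X] {f : Fin N → Ω → X} (hf : ∀ n, MemLp (f n) 2 μ) :
    Integrable (fun ω => rademacherSq fun n => f n ω) μ := by
  unfold rademacherSq
  refine (integrable_finsetSum _ fun ε _ => MemLp.integrable_sq_norm ?_).div_const _
  refine memLp_finsetSum _ fun n _ => ?_
  rcases Int.units_eq_one_or (ε n) with h | h
  · simpa [h] using hf n
  · simp only [h, Units.val_neg, Units.val_one, neg_one_smul]
    rw [show (fun ω => -f n ω) = -f n from rfl]
    exact (hf n).neg

/-- The signs of the Gaussians are absorbed by the Rademacher signs, so each `g (i n)` may be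
replaced by its modulus. Jensen's inequality then replaces the moduli by their common mean.
Independence plays no role, so `i` may repeat indices. -/
theorem rademacherSq_le_integral_gaussian [CompleteSpace E] {M N : ℕ} (i : Fin N → Fin M)
    (v : Fin N → E) :
    gaussianAbsMoment ^ 2 * rademacherSq v ≤
      ∫ g, rademacherSq (fun n => (g (i n) : ℂ) • v n) ∂(stdGaussianPi M) := by
  have habs := fun g : Fin M → ℝ => rademacherSq_abs_smul (fun n => g (i n)) v
  simp only [← habs]
  unfold rademacherSq
  rw [integral_div, ← mul_div_assoc, Finset.mul_sum]
  have hm : ∀ ε : Fin N → ℤˣ, MemLp (fun g : Fin M → ℝ =>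
      ∑ n, ((ε n : ℤˣ) : ℤ) • (((|g (i n)| : ℝ) : ℂ) • v n)) 2 (stdGaussianPi M) := by
    intro ε
    refine memLp_finsetSum _ fun n _ => ?_
    simp only [smul_comm ((ε n : ℤˣ) : ℤ)]
    exact memLp_abs_eval_smul _ _
  rw [integral_finsetSum _ fun ε _ => (hm ε).integrable_sq_norm]
  gcongr with ε
  refine le_trans (le_of_eq ?_) (sq_norm_integral_le (hm ε))
  rw [integral_finsetSum]
  · have : ∀ n, ∫ g, ((ε n : ℤˣ) : ℤ) • (((|g (i n)| : ℝ) : ℂ) • v n) ∂(stdGaussianPi M)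
        = gaussianAbsMoment • (((ε n : ℤˣ) : ℤ) • v n) := by
      intro n
      simp only [smul_comm ((ε n : ℤˣ) : ℤ), Complex.coe_smul]
      rw [integral_smul_const, integral_abs_eval_stdGaussianPi]
    simp only [this]
    rw [← Finset.smul_sum, norm_smul, mul_pow, Real.norm_of_nonneg gaussianAbsMoment_pos.le]
  · intro n _
    simp only [smul_comm ((ε n : ℤˣ) : ℤ)]
    exact (memLp_abs_eval_smul _ _).integrable (by norm_num)

/-- Off-diagonal terms can be dropped from mixed Gaussian and Rademacher double sums. -/
theorem integral_rademacherSq_diagonal_le {M N : ℕ} (i : Fin N → Fin M) (v : Fin N → Fin M → E) :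
    ∫ g, rademacherSq (fun n => (g (i n) : ℂ) • v n (i n)) ∂(stdGaussianPi M) ≤
      ∫ g, rademacherSq (fun n => gaussianSum (v n) g) ∂(stdGaussianPi M) := by
  have hI : Integrable (fun g => rademacherSq fun n => gaussianSum (v n) g) (stdGaussianPi M) :=
    integrable_rademacherSq fun n => memLp_gaussianSum _
  -- Flip the Gaussians by `s` and multiply the `n`-th term by `s (i n)`. Neither changes the
  -- integrated average, while summing over `s` keeps exactly the diagonal terms, by orthogonality
  -- of signs.
  set flip : (Fin M → ℤˣ) → (Fin M → ℝ) → Fin M → ℝ := fun s g m => (((s m : ℤˣ) : ℤ) : ℝ) * g m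
  have hflip : ∀ s, ∫ g, rademacherSq (fun n => ((s (i n) : ℤˣ) : ℤ) • gaussianSum (v n) (flip s g))
      ∂(stdGaussianPi M) = ∫ g, rademacherSq (fun n => gaussianSum (v n) g) ∂(stdGaussianPi M) := by
    intro s
    simp only [rademacherSq_units_smul (fun n => s (i n))]
    have hmp := measurePreserving_units_mul s
    conv_rhs => rw [← hmp.map_eq]
    rw [integral_map hmp.measurable.aemeasurable]
    rw [hmp.map_eq]
    exact hI.1
  have hIs : ∀ s, Integrable (fun g => rademacherSq
      (fun n => ((s (i n) : ℤˣ) : ℤ) • gaussianSum (v n) (flip s g))) (stdGaussianPi M) := by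
    intro s
    simp only [rademacherSq_units_smul (fun n => s (i n))]
    exact (measurePreserving_units_mul s).integrable_comp_of_integrable hI
  have hsum : ∀ g n, ∑ s : Fin M → ℤˣ, ((s (i n) : ℤˣ) : ℤ) • gaussianSum (v n) (flip s g)
      = (2 ^ M : ℤ) • ((g (i n) : ℂ) • v n (i n)) := by
    intro g n
    have h1 : ∀ s : Fin M → ℤˣ, ((s (i n) : ℤˣ) : ℤ) • gaussianSum (v n) (flip s g)
        = ∑ m, (((s (i n) : ℤˣ) : ℤ) * ((s m : ℤˣ) : ℤ)) • ((g m : ℂ) • v n m) := by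
      intro s
      rw [gaussianSum, Finset.smul_sum]
      refine Finset.sum_congr rfl fun m _ => ?_
      rw [mul_smul]
      congr 1
      rcases Int.units_eq_one_or (s m) with h | h <;> simp [flip, h]
    simp only [h1]
    rw [Finset.sum_comm]
    simp only [← Finset.sum_smul, sum_units_mul_units, ite_smul, zero_smul]
    simp
  -- Cauchy–Schwarz over the `2 ^ M` sign vectors.
  have hpt : ∀ g, (2 : ℝ) ^ M * rademacherSq (fun n => (g (i n) : ℂ) • v n (i n)) ≤
      ∑ s, rademacherSq (fun n => ((s (i n) : ℤˣ) : ℤ) • gaussianSum (v n) (flip s g)) := by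
    intro g
    unfold rademacherSq
    rw [← Finset.sum_div, ← mul_div_assoc, Finset.sum_comm, Finset.mul_sum]
    gcongr with ε
    have h2 := norm_sum_sq_le fun s : Fin M → ℤˣ =>
      ∑ n, ((ε n : ℤˣ) : ℤ) • ((s (i n) : ℤˣ) : ℤ) • gaussianSum (v n) (flip s g)
    have h3 : ∑ s : Fin M → ℤˣ, ∑ n, ((ε n : ℤˣ) : ℤ) • ((s (i n) : ℤˣ) : ℤ) •
        gaussianSum (v n) (flip s g)
        = ((2 : ℝ) ^ M) • ∑ n, ((ε n : ℤˣ) : ℤ) • ((g (i n) : ℂ) • v n (i n)) := by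
      rw [Finset.sum_comm]
      simp only [← Finset.smul_sum, hsum]
      rw [Finset.smul_sum]
      refine Finset.sum_congr rfl fun n _ => ?_
      rw [smul_comm, ← Int.cast_smul_eq_zsmul ℝ]
      push_cast
      rfl
    rw [h3, norm_smul, mul_pow] at h2
    simp only [Fintype.card_pi, Fintype.card_units_int, Finset.prod_const, Finset.card_univ,
      Fintype.card_fin] at h2
    push_cast at h2
    have h4 : ‖(2 : ℝ) ^ M‖ = 2 ^ M := by simp
    rw [h4, pow_two ((2 : ℝ) ^ M), mul_assoc] at h2
    exact le_of_mul_le_mul_left h2 (by positivity)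
  have h5 : (2 : ℝ) ^ M * ∫ g, rademacherSq (fun n => (g (i n) : ℂ) • v n (i n)) ∂(stdGaussianPi M)
      ≤ 2 ^ M * ∫ g, rademacherSq (fun n => gaussianSum (v n) g) ∂(stdGaussianPi M) := by
    rw [← integral_const_mul]
    refine (integral_mono ((integrable_rademacherSq fun n => memLp_eval_smul _ _).const_mul _)
      (integrable_finsetSum _ fun s _ => hIs s) hpt).trans ?_
    rw [integral_finsetSum _ fun s _ => hIs s]
    simp only [hflip]
    simp
  exact le_of_mul_le_mul_left h5 (by positivity)

end SignAverages

/-! ### `R`-boundedness along an orthonormal system -/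

section OrthonormalFamilies

variable {H F E : Type*} [NormedAddCommGroup H] [InnerProductSpace ℂ H]
  [NormedAddCommGroup F] [NormedSpace ℂ F] [NormedAddCommGroup E] [NormedSpace ℂ E]

theorem AlmostSumming.integral_gaussianSum_le (R : AlmostSumming H E) {M : ℕ} {h : Fin M → H}
    (hh : Orthonormal ℂ h) :
    ∫ g, ‖gaussianSum (fun m => AlmostSumming.incl H E R (h m)) g‖ ^ 2 ∂(stdGaussianPi M)
      ≤ ‖R‖ ^ 2 := by
  have hm := memLp_gaussianSum fun m => AlmostSumming.incl H E R (h m)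
  have h1 : eLpNorm (gaussianSum fun m => AlmostSumming.incl H E R (h m)) 2 (stdGaussianPi M)
      ≤ gammaENorm (AlmostSumming.inclₗ H E R) :=
    le_iSup_of_le M (le_iSup_of_le h (le_iSup_of_le hh le_rfl))
  have h2 := ENNReal.toReal_mono (AlmostSumming.gammaENorm_ne_top R) h1
  rw [← AlmostSumming.norm_def, hm.eLpNorm_eq_integral_rpow_norm (by norm_num) (by norm_num),
    ENNReal.toReal_ofReal (by positivity)] at h2
  simp only [ENNReal.toReal_ofNat, Real.rpow_ofNat] at h2
  have h3 : 0 ≤ ∫ g, ‖gaussianSum (fun m => AlmostSumming.incl H E R (h m)) g‖ ^ 2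
    ∂(stdGaussianPi M) := integral_nonneg fun _ => by positivity
  rw [← one_div, ← Real.sqrt_eq_rpow] at h2
  exact Real.sqrt_le_iff.1 h2 |>.2

variable [CompleteSpace E] (Θ : F →L[ℂ] AlmostSumming H E)

theorem rademacherSq_apply_orthonormal_le {M N : ℕ} {h : Fin M → H} (hh : Orthonormal ℂ h)
    (i : Fin N → Fin M) (x : Fin N → F) :
    rademacherSq (fun n => AlmostSumming.incl H E (Θ (x n)) (h (i n)))
      ≤ (‖Θ‖ / gaussianAbsMoment) ^ 2 * rademacherSq x := by
  have h1 := (rademacherSq_le_integral_gaussian i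
    fun n => AlmostSumming.incl H E (Θ (x n)) (h (i n))).trans
    (integral_rademacherSq_diagonal_le i fun n m => AlmostSumming.incl H E (Θ (x n)) (h m))
  have h2 : ∫ g, rademacherSq
      (fun n => gaussianSum (fun m => AlmostSumming.incl H E (Θ (x n)) (h m)) g) ∂(stdGaussianPi M)
      ≤ ‖Θ‖ ^ 2 * rademacherSq x := by
    -- For fixed signs the double sum is the Gaussian sum of `Θ` at one vector of `F`, so the `γ_∞`
    -- norm applies.
    have key : ∀ (ε : Fin N → ℤˣ) (g : Fin M → ℝ), ∑ n, ((ε n : ℤˣ) : ℤ) •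
        gaussianSum (fun m => AlmostSumming.incl H E (Θ (x n)) (h m)) g
        = gaussianSum (fun m => AlmostSumming.incl H E (Θ (∑ n, ((ε n : ℤˣ) : ℤ) • x n)) (h m))
          g := by
      intro ε g
      simp only [gaussianSum, map_sum, map_zsmul, sum_apply,
        smul_apply, Finset.smul_sum]
      rw [Finset.sum_comm]
      exact Finset.sum_congr rfl fun m _ => Finset.sum_congr rfl fun n _ => smul_comm _ _ _
    unfold rademacherSq
    simp only [key]
    rw [integral_div, integral_finsetSum _ fun ε _ => (memLp_gaussianSum _).integrable_sq_norm,
      ← mul_div_assoc, Finset.mul_sum]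
    gcongr with ε
    refine (AlmostSumming.integral_gaussianSum_le _ hh).trans ?_
    rw [← mul_pow]
    gcongr
    exact Θ.le_opNorm _
  have h3 := h1.trans h2
  rw [div_pow, div_mul_eq_mul_div, le_div_iff₀ (pow_pos gaussianAbsMoment_pos 2), mul_comm]
  exact h3

theorem isRBoundedWith_orthonormal {ι : Type*} {h : ι → H} (hh : Orthonormal ℂ h) :
    IsRBoundedWith (Set.range fun k => (AlmostSumming.incl H E ∘L Θ).flip (h k))
      (‖Θ‖ / gaussianAbsMoment) := by
  intro N T x hT
  choose k hk using hT
  classical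
  set s : Finset ι := Finset.univ.image k
  set e := s.equivFin
  have h1 := rademacherSq_apply_orthonormal_le Θ
    (hh.comp (fun m => (e.symm m : ι)) (Subtype.val_injective.comp e.symm.injective))
    (fun n => e ⟨k n, by simp [s]⟩) x
  have h2 : (fun n => T n (x n)) = fun n => AlmostSumming.incl H E (Θ (x n)) (h (k n)) := by
    funext n
    rw [← hk n]
    rfl
  rw [h2]
  simpa using h1

end OrthonormalFamilies

/-! ### Fourier coefficients of the even extension of an exponential -/

section FourierCoefficients

/-- Each term is dominated by a telescoping difference of `4α / (α + n)`; this is where `1 ≤ α`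
enters, through `(α + n)(α + n + 1) ≤ 4(α² + n²)`. -/
theorem sum_poisson_nat_le {α : ℝ} (hα : 1 ≤ α) (K : ℕ) :
    ∑ n ∈ Finset.range K, α / (α ^ 2 + (n : ℝ) ^ 2) ≤ 4 := by
  have h1 : ∀ n : ℕ, α / (α ^ 2 + (n : ℝ) ^ 2)
      ≤ 4 * (α / (α + n)) - 4 * (α / (α + ((n + 1 : ℕ) : ℝ))) := by
    intro n
    have hn : (0 : ℝ) ≤ n := n.cast_nonneg
    have h : 4 * (α / (α + n)) - 4 * (α / (α + ((n + 1 : ℕ) : ℝ)))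
        = 4 * α / ((α + n) * (α + n + 1)) := by
      push_cast
      field_simp
      ring
    rw [h, div_le_div_iff₀ (by positivity) (by positivity)]
    have : (α + n) * (α + n + 1) ≤ 4 * (α ^ 2 + n ^ 2) := by
      nlinarith [sq_nonneg (α - n)]
    nlinarith
  refine (Finset.sum_le_sum fun n _ => h1 n).trans ?_
  rw [Finset.sum_range_sub' (fun n : ℕ => 4 * (α / (α + n)))]
  have : 0 ≤ 4 * (α / (α + K)) := by positivity
  have h2 : 4 * (α / (α + ((0 : ℕ) : ℝ))) = 4 := by
    rw [Nat.cast_zero, add_zero, div_self (by linarith), mul_one]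
  linarith

theorem sum_poisson_int_le {α : ℝ} (hα : 1 ≤ α) (s : Finset ℤ) :
    ∑ n ∈ s, α / (α ^ 2 + (n : ℝ) ^ 2) ≤ 8 := by
  set f : ℤ → ℝ := fun n => α / (α ^ 2 + (n : ℝ) ^ 2)
  have hf : ∀ n, 0 ≤ f n := fun n => by positivity
  have hp : ∀ K, ∑ n ∈ Finset.range K, f (n : ℕ) ≤ 4 := by
    simpa [f] using sum_poisson_nat_le hα
  have hn : ∀ K, ∑ n ∈ Finset.range K, f (-((n : ℕ) + 1)) ≤ 4 := by
    intro K
    refine le_trans (Finset.sum_le_sum fun n _ => ?_) (hp K)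
    simp only [f]
    push_cast
    have : (0 : ℝ) ≤ n := n.cast_nonneg
    rw [neg_sq]
    gcongr
    linarith
  have h1 := summable_of_sum_range_le (fun n => hf n) hp
  have h2 := summable_of_sum_range_le (fun n => hf _) hn
  have h3 := Summable.of_nat_of_neg_add_one h1 h2
  refine (h3.sum_le_tsum s fun n _ => hf n).trans ?_
  rw [tsum_of_nat_of_neg_add_one h1 h2]
  linarith [Real.tsum_le_of_sum_range_le (fun n => hf _) hp,
    Real.tsum_le_of_sum_range_le (fun n => hf _) hn]

variable {L : ℝ}

/-- The even `2L`-periodic function that equals `exp (-l t)` for `0 ≤ t ≤ L`. -/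
def evenExp (L : ℝ) (l : ℂ) : C(AddCircle (2 * L), ℂ) where
  toFun x := Complex.exp (-l * (‖x‖ : ℝ))
  continuous_toFun := by fun_prop

theorem evenExp_coe (hL : 0 < L) (l : ℂ) {t : ℝ} (ht : |t| ≤ L) :
    evenExp L l (t : AddCircle (2 * L)) = Complex.exp (-l * (|t| : ℝ)) := by
  have : ‖(t : AddCircle (2 * L))‖ = |t| := by
    have h2 : 0 < 2 * L := by positivity
    rw [AddCircle.norm_coe_eq_abs_iff _ h2.ne', abs_of_pos h2]
    linarith
  simp [evenExp, this]

theorem fourier_two_mul_coe (hL : 0 < L) (n : ℤ) (t : ℝ) :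
    fourier n (t : AddCircle (2 * L)) = Complex.exp (((Real.pi * n / L : ℝ) * Complex.I) * t) := by
  rw [fourier_coe_apply]
  congr 1
  have : (L : ℂ) ≠ 0 := by exact_mod_cast hL.ne'
  push_cast
  field_simp

theorem fourierCoeff_evenExp [hT : Fact (0 < 2 * L)] {l : ℂ} (hl : 0 < l.re) (n : ℤ) :
    fourierCoeff (evenExp L l) n = (1 / (2 * L) : ℝ) *
      ((1 - Complex.exp (-l * L) * Complex.exp ((Real.pi * n : ℝ) * Complex.I)) *
        (2 * l / (l ^ 2 + ((Real.pi * n / L : ℝ) : ℂ) ^ 2))) := by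
  have hL : 0 < L := by linarith [hT.out]
  set b : ℝ := Real.pi * n / L with hb
  have hbL : b * L = Real.pi * n := by rw [hb]; field_simp
  have hne : l - b * Complex.I ≠ 0 := fun h => by
    have := congrArg Complex.re h; simp at this; linarith
  have hne' : -(l + b * Complex.I) ≠ 0 := fun h => by
    have := congrArg Complex.re h; simp at this; linarith
  -- Both sides are `(-1)ⁿ`: the endpoints `-L` and `L` are the same point of the circle.
  have hw : Complex.exp (-((Real.pi * n : ℝ) * Complex.I))
      = Complex.exp ((Real.pi * n : ℝ) * Complex.I) := by
    rw [Complex.exp_eq_exp_iff_exists_int]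
    exact ⟨-n, by push_cast; ring⟩
  rw [fourierCoeff_eq_intervalIntegral _ n (-L), show -L + 2 * L = L by ring]
  have hint : ∀ p q : ℝ, IntervalIntegrable
      (fun x : ℝ => fourier (-n) (x : AddCircle (2 * L)) • evenExp L l x) volume p q := fun p q =>
    Continuous.intervalIntegrable (by
      have h1 : Continuous fun x : ℝ => (x : AddCircle (2 * L)) := AddCircle.continuous_mk' _
      fun_prop) _ _
  rw [← intervalIntegral.integral_add_adjacent_intervals (hint (-L) 0) (hint 0 L)]
  have e1 : ∫ x in (-L)..0, fourier (-n) (x : AddCircle (2 * L)) • evenExp L l x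
      = ∫ x in (-L)..0, Complex.exp ((l - b * Complex.I) * x) := by
    refine intervalIntegral.integral_congr fun x hx => ?_
    rw [Set.uIcc_of_le (by linarith)] at hx
    have habs : |x| = -x := abs_of_nonpos hx.2
    simp only [smul_eq_mul]
    rw [fourier_two_mul_coe hL, evenExp_coe hL l (by rw [habs]; linarith [hx.1]), ← Complex.exp_add,
      habs]
    congr 1
    push_cast [hb]
    ring
  have e2 : ∫ x in (0 : ℝ)..L, fourier (-n) (x : AddCircle (2 * L)) • evenExp L l x
      = ∫ x in (0 : ℝ)..L, Complex.exp (-(l + b * Complex.I) * x) := by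
    refine intervalIntegral.integral_congr fun x hx => ?_
    rw [Set.uIcc_of_le hL.le] at hx
    have habs : |x| = x := abs_of_nonneg hx.1
    simp only [smul_eq_mul]
    rw [fourier_two_mul_coe hL, evenExp_coe hL l (by rw [habs]; linarith [hx.2]), ← Complex.exp_add,
      habs]
    congr 1
    push_cast [hb]
    ring
  rw [e1, e2, integral_exp_mul_complex hne, integral_exp_mul_complex hne']
  have x1 : Complex.exp ((l - b * Complex.I) * (-L : ℝ))
      = Complex.exp (-l * L) * Complex.exp ((Real.pi * n : ℝ) * Complex.I) := by
    rw [← Complex.exp_add, ← hbL]; congr 1; push_cast; ring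
  have x2 : Complex.exp (-(l + b * Complex.I) * L)
      = Complex.exp (-l * L) * Complex.exp ((Real.pi * n : ℝ) * Complex.I) := by
    rw [← hw, ← Complex.exp_add, ← hbL]; congr 1; push_cast; ring
  rw [x1, x2]
  have hsq : l ^ 2 + (b : ℂ) ^ 2 = (l - b * Complex.I) * (l + b * Complex.I) := by
    ring_nf; simp
  have hne2 : l + b * Complex.I ≠ 0 := fun h => hne' (by rw [h, neg_zero])
  rw [hsq, Complex.real_smul]
  congr 1
  simp only [Complex.ofReal_zero, mul_zero, Complex.exp_zero]
  rw [show 2 * l = (l - b * Complex.I) + (l + b * Complex.I) by ring, neg_eq_neg_one_mul]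
  generalize Complex.exp (-l * L) * Complex.exp ((Real.pi * n : ℝ) * Complex.I) = X
  generalize l - b * Complex.I = p at *
  generalize l + b * Complex.I = q at *
  field_simp
  ring

/-- The hypotheses give `|Im l| ≤ Re l / 2`, which keeps `l² + (πn/L)²` away from zero: its real
part is at least `3/4` of `(Re l)² + (πn/L)²`. The result is a Poisson-type kernel with parameter
`Re l * L / π ≥ 1`. -/
theorem norm_fourierCoeff_evenExp_le [hT : Fact (0 < 2 * L)] {l : ℂ} (hl : Real.pi / L ≤ l.re)
    (hl' : |l.im| ≤ Real.pi / (2 * L)) (n : ℤ) :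
    ‖fourierCoeff (evenExp L l) n‖
      ≤ 4 / Real.pi * ((l.re * L / Real.pi) / ((l.re * L / Real.pi) ^ 2 + (n : ℝ) ^ 2)) := by
  have hL : 0 < L := by linarith [hT.out]
  have hpi := Real.pi_pos
  have ha : 0 < l.re := lt_of_lt_of_le (by positivity) hl
  have him : |l.im| ≤ l.re / 2 := by
    have : Real.pi / (2 * L) = Real.pi / L / 2 := by field_simp
    linarith
  rw [fourierCoeff_evenExp ha]
  set b : ℝ := Real.pi * n / L with hb
  have h1 : ‖1 - Complex.exp (-l * L) * Complex.exp ((Real.pi * n : ℝ) * Complex.I)‖ ≤ 2 := by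
    refine (norm_sub_le _ _).trans ?_
    rw [norm_mul, Complex.norm_exp_ofReal_mul_I, mul_one, Complex.norm_exp, norm_one]
    have : Real.exp (-l * L).re ≤ 1 := Real.exp_le_one_iff.2 (by simp; positivity)
    linarith
  have h2 : ‖l‖ ≤ 3 / 2 * l.re := by
    have := Complex.norm_le_abs_re_add_abs_im l
    rw [abs_of_pos ha] at this
    linarith
  have h3 : 3 / 4 * (l.re ^ 2 + b ^ 2) ≤ ‖l ^ 2 + (b : ℂ) ^ 2‖ := by
    refine le_trans ?_ (Complex.re_le_norm _)
    have : (l ^ 2 + (b : ℂ) ^ 2).re = l.re ^ 2 - l.im ^ 2 + b ^ 2 := by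
      simp [pow_two]
    rw [this]
    have : l.im ^ 2 ≤ (l.re / 2) ^ 2 := by
      rw [← sq_abs]; gcongr
    nlinarith [sq_nonneg b]
  rw [norm_mul, norm_mul, norm_div, norm_mul, Complex.norm_real, Complex.norm_two,
    Real.norm_of_nonneg (by positivity)]
  calc 1 / (2 * L) * (‖1 - Complex.exp (-l * L) * Complex.exp ((Real.pi * n : ℝ) * Complex.I)‖ *
        (2 * ‖l‖ / ‖l ^ 2 + (b : ℂ) ^ 2‖))
      ≤ 1 / (2 * L) * (2 * (2 * (3 / 2 * l.re) / (3 / 4 * (l.re ^ 2 + b ^ 2)))) := by gcongr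
    _ = _ := by
      have : l.re ^ 2 + b ^ 2 = (Real.pi / L) ^ 2 * ((l.re * L / Real.pi) ^ 2 + (n : ℝ) ^ 2) := by
        rw [hb]; field_simp
      rw [this]
      have : (l.re * L / Real.pi) ^ 2 + (n : ℝ) ^ 2 ≠ 0 := by positivity
      field_simp

theorem sum_norm_fourierCoeff_evenExp_le [hT : Fact (0 < 2 * L)] {l : ℂ}
    (hl : Real.pi / L ≤ l.re) (hl' : |l.im| ≤ Real.pi / (2 * L)) (s : Finset ℤ) :
    ∑ n ∈ s, ‖fourierCoeff (evenExp L l) n‖ ≤ 11 := by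
  have hL : 0 < L := by linarith [hT.out]
  refine (Finset.sum_le_sum fun n _ => norm_fourierCoeff_evenExp_le hl hl' n).trans ?_
  rw [← Finset.mul_sum]
  have hα : 1 ≤ l.re * L / Real.pi := by
    rw [le_div_iff₀ Real.pi_pos, one_mul]
    exact (div_le_iff₀ hL).1 hl
  have h1 := sum_poisson_int_le hα s
  -- The constant 11 comes from `8 * 4/3 < 11`.
  have h2 : 4 / Real.pi ≤ 4 / 3 := by
    have := Real.pi_gt_three
    gcongr
  have h3 : (0 : ℝ) < 4 / Real.pi := by positivity
  nlinarith

end FourierCoefficients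

/-! ### Exponentials on windows of length `L` -/

section Windows

variable {L : ℝ}

/-- The restriction of a `2L`-periodic function to a half period, moved to `[jL, (j+1)L)`. -/
def windowFun (L : ℝ) (j : ℕ) (f : C(AddCircle (2 * L), ℂ)) : ℝ → ℂ :=
  (Set.Ico (j * L) ((j + 1) * L)).indicator fun t => f ((t - j * L : ℝ) : AddCircle (2 * L))

theorem volume_restrict_Ico_ne_top (a b : ℝ) :
    (volume.restrict (Set.Ici (0 : ℝ))) (Set.Ico a b) ≠ ∞ :=
  ((Measure.restrict_apply_le _ _).trans_lt (by simp)).ne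

theorem norm_windowFun_le [Fact (0 < 2 * L)] (j : ℕ) (f : C(AddCircle (2 * L), ℂ)) (t : ℝ) :
    ‖windowFun L j f t‖
      ≤ ‖f‖ * ‖(Set.Ico (j * L) ((j + 1) * L)).indicator (fun _ => (1 : ℂ)) t‖ := by
  unfold windowFun
  by_cases ht : t ∈ Set.Ico (j * L) ((j + 1) * L)
  · simpa [ht] using f.norm_coe_le_norm _
  · simp [ht]

theorem memLp_windowFun [Fact (0 < 2 * L)] (j : ℕ) (f : C(AddCircle (2 * L), ℂ)) :
    MemLp (windowFun L j f) 2 (volume.restrict (Set.Ici (0 : ℝ))) := by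
  refine (memLp_indicator_const 2 measurableSet_Ico (1 : ℂ)
    (Or.inr (volume_restrict_Ico_ne_top _ _))).of_le_mul ?_
    (Filter.Eventually.of_forall (norm_windowFun_le j f))
  refine AEStronglyMeasurable.indicator ?_ measurableSet_Ico
  have h1 : Continuous fun x : ℝ => (x : AddCircle (2 * L)) := AddCircle.continuous_mk' _
  exact (f.continuous.comp (h1.comp (continuous_id.sub continuous_const))).aestronglyMeasurable

/-- `windowFun` as a bounded linear operator into `L²(ℝ₊)`. -/
def windowLp (L : ℝ) [Fact (0 < 2 * L)] (j : ℕ) : C(AddCircle (2 * L), ℂ) →L[ℂ] L2Rplus :=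
  LinearMap.mkContinuous
    { toFun := fun f => (memLp_windowFun j f).toLp _
      map_add' := fun f g => by
        rw [← MemLp.toLp_add]
        congr 1
        funext t
        simp only [windowFun, Pi.add_apply, Set.indicator_apply]
        split_ifs <;> simp
      map_smul' := fun c f => by
        rw [RingHom.id_apply, ← MemLp.toLp_const_smul]
        congr 1
        funext t
        simp only [windowFun, Pi.smul_apply, Set.indicator_apply]
        split_ifs <;> simp }
    ‖indicatorConstLp 2 (μ := volume.restrict (Set.Ici (0 : ℝ))) measurableSet_Ico
      (volume_restrict_Ico_ne_top (j * L) ((j + 1) * L)) (1 : ℂ)‖ fun f => by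
    refine (Lp.norm_le_mul_norm_of_ae_le_mul ?_).trans_eq (mul_comm _ _)
    filter_upwards [(memLp_windowFun j f).coeFn_toLp, indicatorConstLp_coeFn (p := 2)
      (hs := measurableSet_Ico) (hμs := volume_restrict_Ico_ne_top (j * L) ((j + 1) * L))
      (c := (1 : ℂ))] with t h1 h2
    rw [h2]
    simp only [LinearMap.coe_mk, AddHom.coe_mk]
    rw [h1]
    exact norm_windowFun_le j f t

theorem coeFn_windowLp [Fact (0 < 2 * L)] (j : ℕ) (f : C(AddCircle (2 * L), ℂ)) :
    windowLp L j f =ᵐ[volume.restrict (Set.Ici (0 : ℝ))] windowFun L j f :=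
  (memLp_windowFun j f).coeFn_toLp

theorem inner_windowLp_of_ne [hT : Fact (0 < 2 * L)] {j j' : ℕ} (h : j ≠ j')
    (f g : C(AddCircle (2 * L), ℂ)) : inner ℂ (windowLp L j f) (windowLp L j' g) = 0 := by
  have hL : 0 < L := by linarith [hT.out]
  rw [L2.inner_def]
  refine integral_eq_zero_of_ae ?_
  filter_upwards [coeFn_windowLp j f, coeFn_windowLp j' g] with t h1 h2
  rw [h1, h2]
  by_cases hj : t ∈ Set.Ico (j * L) ((j + 1) * L)
  · have hj' : t ∉ Set.Ico (j' * L) ((j' + 1) * L) := by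
      rintro ⟨h3, h4⟩
      have h5 : (j : ℝ) < j' + 1 := lt_of_mul_lt_mul_right (hj.1.trans_lt h4) hL.le
      have h6 : (j' : ℝ) < j + 1 := lt_of_mul_lt_mul_right (h3.trans_lt hj.2) hL.le
      norm_cast at h5 h6
      omega
    simp [windowFun, hj']
  · simp [windowFun, hj]

theorem inner_windowLp_self [hT : Fact (0 < 2 * L)] (j : ℕ) (f g : C(AddCircle (2 * L), ℂ)) :
    inner ℂ (windowLp L j f) (windowLp L j g)
      = ∫ u in (0 : ℝ)..L, inner ℂ (f (u : AddCircle (2 * L))) (g (u : AddCircle (2 * L))) := by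
  have hL : 0 < L := by linarith [hT.out]
  rw [L2.inner_def]
  have h1 : ∫ t, inner ℂ (windowLp L j f t) (windowLp L j g t) ∂(volume.restrict (Set.Ici (0 : ℝ)))
      = ∫ t, (Set.Ico (j * L) ((j + 1) * L)).indicator (fun t =>
        inner ℂ (f ((t - j * L : ℝ) : AddCircle (2 * L)))
          (g ((t - j * L : ℝ) : AddCircle (2 * L)))) t ∂(volume.restrict (Set.Ici (0 : ℝ))) := by
    refine integral_congr_ae ?_
    filter_upwards [coeFn_windowLp j f, coeFn_windowLp j g] with t h1 h2
    rw [h1, h2]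
    by_cases hj : t ∈ Set.Ico (j * L) ((j + 1) * L) <;> simp [windowFun, hj]
  have h2 : Set.Ico (j * L) ((j + 1) * L) ∩ Set.Ici 0 = Set.Ico (j * L) ((j + 1) * L) := by
    refine Set.inter_eq_left.2 fun t ht => ?_
    have : 0 ≤ j * L := by positivity
    exact this.trans ht.1
  rw [h1, integral_indicator measurableSet_Ico, Measure.restrict_restrict measurableSet_Ico, h2,
    integral_Ico_eq_integral_Ioc, ← intervalIntegral.integral_of_le (by nlinarith),
    intervalIntegral.integral_comp_sub_right (fun u : ℝ =>
        inner ℂ (f (u : AddCircle (2 * L))) (g (u : AddCircle (2 * L)))) (j * L)]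
  congr 1 <;> ring

/-- Indices of equal parity differ by an even integer, so the product of exponentials completes
whole periods on the half period `[0, L]`. -/
theorem integral_inner_fourier [hT : Fact (0 < 2 * L)] (d d' p : ℤ) :
    ∫ u in (0 : ℝ)..L, inner ℂ (fourier (2 * d + p) (u : AddCircle (2 * L)))
      (fourier (2 * d' + p) (u : AddCircle (2 * L))) = if d = d' then (L : ℂ) else 0 := by
  have hL : 0 < L := by linarith [hT.out]
  have h1 : ∀ u : ℝ, inner ℂ (fourier (2 * d + p) (u : AddCircle (2 * L)))
      (fourier (2 * d' + p) (u : AddCircle (2 * L)))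
      = Complex.exp (((Real.pi * (2 * (d' - d) : ℤ) / L : ℝ) * Complex.I) * u) := by
    intro u
    rw [RCLike.inner_apply, ← fourier_neg, ← fourier_add, fourier_two_mul_coe hL]
    congr 5
    push_cast
    ring
  simp only [h1]
  split_ifs with h
  · simp [h]
  · have hne : ((Real.pi * (2 * (d' - d) : ℤ) / L : ℝ) * Complex.I) ≠ 0 := by
      refine mul_ne_zero ?_ Complex.I_ne_zero
      have h2 : ((2 * (d' - d) : ℤ) : ℝ) ≠ 0 := by exact_mod_cast (by omega)
      exact_mod_cast div_ne_zero (mul_ne_zero Real.pi_ne_zero h2) hL.ne'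
    rw [integral_exp_mul_complex hne]
    have h3 : Complex.exp (((Real.pi * (2 * (d' - d) : ℤ) / L : ℝ) * Complex.I) * L) = 1 := by
      rw [Complex.exp_eq_one_iff]
      refine ⟨d' - d, ?_⟩
      have : (L : ℂ) ≠ 0 := by exact_mod_cast hL.ne'
      push_cast
      field_simp
    rw [h3]
    simp

/-- The normalized exponential of frequency `πk/L` on `[jL, (j+1)L)`. -/
def windowExp (L : ℝ) [Fact (0 < 2 * L)] (j : ℕ) (k : ℤ) : L2Rplus :=
  ((√L)⁻¹ : ℂ) • windowLp L j (fourier k)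

/-- The exponentials whose frequencies have a given parity form an orthonormal system. -/
theorem orthonormal_windowExp [hT : Fact (0 < 2 * L)] (p : ℤ) :
    Orthonormal ℂ fun q : ℕ × ℤ => windowExp L q.1 (2 * q.2 + p) := by
  have hL : 0 < L := by linarith [hT.out]
  classical
  rw [orthonormal_iff_ite]
  rintro ⟨j, d⟩ ⟨j', d'⟩
  simp only [windowExp, inner_smul_left, inner_smul_right, Prod.mk.injEq]
  by_cases hj : j = j'
  · subst hj
    rw [inner_windowLp_self, integral_inner_fourier]
    by_cases hd : d = d'
    · have h1 : (√L : ℂ) ≠ 0 := by exact_mod_cast (Real.sqrt_pos.2 hL).ne'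
      have h2 : (√L : ℂ) * √L = L := by exact_mod_cast Real.mul_self_sqrt hL.le
      simp only [hd, map_inv₀, Complex.conj_ofReal, and_self, if_true]
      rw [← h2]
      field_simp
    · simp [hd]
  · rw [inner_windowLp_of_ne hj]
    simp [hj]

theorem norm_windowExp [Fact (0 < 2 * L)] (j : ℕ) (k : ℤ) : ‖windowExp L j k‖ = 1 := by
  -- The offset `p` may be any integer, so `p = k` with `d = 0` reaches every index.
  simpa using (orthonormal_windowExp (L := L) k).1 (j, 0)

end Windows

/-! ### Expansion of `e_z` in window exponentials -/

section Expansion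

theorem coeFn_expL2 (z : RightHalfPlane) :
    expL2 z =ᵐ[volume.restrict (Set.Ici (0 : ℝ))] fun t : ℝ => Complex.exp (-(z : ℂ) * t) :=
  (memLp_expFun z).coeFn_toLp

/-- An element of `L²(ℝ₊)` is `exp (-z t)` if its pieces on the intervals `[jL, (j+1)L)` are. -/
theorem tendsto_sum_range_expL2 {L : ℝ} (hL : 0 < L) (z : RightHalfPlane) {G : ℕ → L2Rplus}
    (hG : ∀ j, G j =ᵐ[volume.restrict (Set.Ici (0 : ℝ))]
      (Set.Ico (j * L) ((j + 1) * L)).indicator fun t : ℝ => Complex.exp (-(z : ℂ) * t)) :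
    Filter.Tendsto (fun J => ∑ j ∈ Finset.range J, G j) Filter.atTop (nhds (expL2 z)) := by
  have hz := z.2
  have hsum : ∀ J : ℕ, (∑ j ∈ Finset.range J, G j : L2Rplus)
      =ᵐ[volume.restrict (Set.Ici (0 : ℝ))]
      (Set.Iio (J * L)).indicator fun t : ℝ => Complex.exp (-(z : ℂ) * t) := by
    intro J
    induction J with
    | zero =>
      rw [Finset.sum_range_zero]
      filter_upwards [Lp.coeFn_zero ℂ 2 (volume.restrict (Set.Ici (0 : ℝ))),
        ae_restrict_mem measurableSet_Ici] with t h1 h2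
      rw [h1]
      have : ¬ t < 0 := not_lt.2 h2
      simp [this]
    | succ J ih =>
      rw [Finset.sum_range_succ]
      filter_upwards [Lp.coeFn_add (∑ j ∈ Finset.range J, G j) (G J), ih, hG J] with t h1 h2 h3
      rw [h1, Pi.add_apply, h2, h3]
      simp only [Set.indicator_apply, Set.mem_Iio, Set.mem_Ico]
      push_cast
      by_cases h4 : t < J * L
      · have h5 : t < (J + 1) * L := by linarith
        simp [h4, h5]
      · simp [h4, not_lt.1 h4]
  -- For `t ≥ JL`, half of the decay of `exp (-z t)` yields the factor `exp (-Re z * L / 2) ^ J`;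
  -- the other half is the square-integrable majorant `e_w`.
  let w : RightHalfPlane := ⟨(z : ℂ) / 2, by simpa using hz⟩
  rw [tendsto_iff_norm_sub_tendsto_zero]
  have hbound : ∀ J : ℕ, ‖∑ j ∈ Finset.range J, G j - expL2 z‖
      ≤ Real.exp (-((z : ℂ).re * L / 2)) ^ J * ‖expL2 w‖ := by
    intro J
    refine Lp.norm_le_mul_norm_of_ae_le_mul ?_
    filter_upwards [Lp.coeFn_sub (∑ j ∈ Finset.range J, G j) (expL2 z), hsum J, coeFn_expL2 z,
      coeFn_expL2 w] with t h1 h2 h3 h4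
    rw [h1, Pi.sub_apply, h2, h3, h4]
    by_cases h5 : t < J * L
    · simp only [Set.indicator_apply, Set.mem_Iio, h5, if_true, sub_self, norm_zero]
      positivity
    · simp only [Set.indicator_apply, Set.mem_Iio, h5, if_false, zero_sub, norm_neg,
        Complex.norm_exp, ← Real.exp_nat_mul, ← Real.exp_add]
      refine Real.exp_le_exp.2 ?_
      simp [w]
      nlinarith
  refine squeeze_zero (fun _ => norm_nonneg _) hbound ?_
  have h0 : Real.exp (-((z : ℂ).re * L / 2)) < 1 := by
    rw [Real.exp_lt_one_iff]; simp; positivity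
  simpa using (tendsto_pow_atTop_nhds_zero_of_lt_one (Real.exp_pos _).le h0).mul_const ‖expL2 w‖

/-- The functions `e_z` with `Re z ≥ π/L` have uniformly summable coefficients with respect to the
system `windowExp L`. -/
theorem exists_hasSum_windowExp {L : ℝ} [hT : Fact (0 < 2 * L)] (z : RightHalfPlane)
    (hz : Real.pi / L ≤ (z : ℂ).re) :
    ∃ a : ℕ × ℤ → ℂ, (∀ s : Finset (ℕ × ℤ), ∑ q ∈ s, ‖a q‖ ≤ 22 * √L) ∧
      HasSum (fun q => a q • windowExp L q.1 q.2) (expL2 z) := by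
  have hL : 0 < L := by linarith [hT.out]
  have hpi := Real.pi_pos
  -- Removing the nearest frequency `πm/L` leaves an imaginary part of at most `π/(2L)`, so the
  -- coefficient bound is uniform in `Im z`.
  set m : ℤ := round ((z : ℂ).im * L / Real.pi)
  set l : ℂ := z - (Real.pi * m / L : ℝ) * Complex.I with hl
  have hre : l.re = (z : ℂ).re := by simp [hl]
  have him : |l.im| ≤ Real.pi / (2 * L) := by
    have h1 := abs_sub_round ((z : ℂ).im * L / Real.pi)
    have h2 : l.im = ((z : ℂ).im * L / Real.pi - m) * (Real.pi / L) := by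
      simp [hl]; field_simp
    rw [h2, abs_mul, abs_of_pos (by positivity : 0 < Real.pi / L)]
    calc _ ≤ 1 / 2 * (Real.pi / L) := by gcongr
      _ = _ := by field_simp
  set c : ℤ → ℂ := fourierCoeff (evenExp L l)
  have hc : ∀ s : Finset ℤ, ∑ n ∈ s, ‖c n‖ ≤ 11 := fun s =>
    sum_norm_fourierCoeff_evenExp_le (hre ▸ hz) him s
  have hcs : Summable c := .of_norm (summable_of_sum_le (fun _ => norm_nonneg _) hc)
  -- Restoring the removed frequency only shifts the coefficients. Convergence is uniform on the
  -- circle, hence survives `windowLp`.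
  have hfs : HasSum (fun k => c (k + m) • (fourier k : C(AddCircle (2 * L), ℂ)))
      (fourier (-m) * evenExp L l) := by
    have h1 := (hasSum_fourier_series_of_summable hcs).mul_left (fourier (-m))
    rw [← (Equiv.addRight m).hasSum_iff] at h1
    have h2 : ∀ k, c (k + m) • (fourier k : C(AddCircle (2 * L), ℂ))
        = fourier (-m) * (c (k + m) • fourier (k + m)) := by
      intro k
      ext x
      have : fourier k x = fourier (-m) x * fourier (k + m) x := by
        rw [← fourier_add]; congr 2; ring
      rw [ContinuousMap.mul_apply, ContinuousMap.smul_apply, ContinuousMap.smul_apply, this,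
        smul_eq_mul, smul_eq_mul]
      ring
    simp only [h2]
    exact h1
  have hsq : (√L : ℂ) ≠ 0 := by exact_mod_cast (Real.sqrt_pos.2 hL).ne'
  -- The first factor is the value of `e_z` at the left end of the window; `√L` undoes the
  -- normalization of `windowExp`.
  set a : ℕ × ℤ → ℂ := fun q => Complex.exp (-z * (q.1 * L : ℝ)) * (√L * c (q.2 + m)) with ha
  have hdecay : ∀ j : ℕ, ‖Complex.exp (-z * (j * L : ℝ))‖ ≤ (1 / 2) ^ j := by
    intro j
    rw [Complex.norm_exp]
    have h1 : (-(z : ℂ) * (j * L : ℝ)).re = j * (-((z : ℂ).re * L)) := by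
      simp; ring
    rw [h1, Real.exp_nat_mul]
    gcongr
    have h2 : Real.pi ≤ (z : ℂ).re * L := (div_le_iff₀ hL).1 hz
    rw [Real.exp_neg, one_div]
    gcongr
    linarith [Real.add_one_le_exp ((z : ℂ).re * L), Real.pi_gt_three]
  have hsum : ∀ s : Finset (ℕ × ℤ), ∑ q ∈ s, ‖a q‖ ≤ 22 * √L := by
    intro s
    have h1 : s ⊆ s.image Prod.fst ×ˢ s.image Prod.snd := Finset.subset_product
    calc ∑ q ∈ s, ‖a q‖ ≤ ∑ q ∈ s.image Prod.fst ×ˢ s.image Prod.snd, ‖a q‖ :=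
          Finset.sum_le_sum_of_subset_of_nonneg h1 fun _ _ _ => norm_nonneg _
      _ = ∑ j ∈ s.image Prod.fst, ‖Complex.exp (-z * (j * L : ℝ))‖ *
            (√L * ∑ k ∈ s.image Prod.snd, ‖c (k + m)‖) := by
          rw [Finset.sum_product]
          refine Finset.sum_congr rfl fun j _ => ?_
          simp only [ha, norm_mul, Complex.norm_real, Real.norm_of_nonneg (Real.sqrt_nonneg L)]
          rw [Finset.mul_sum, Finset.mul_sum]
      _ ≤ ∑ j ∈ s.image Prod.fst, (1 / 2) ^ j * (√L * 11) := by
          gcongr with j _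
          · exact hdecay j
          · have := hc ((s.image Prod.snd).map (Equiv.addRight m).toEmbedding)
            simpa using this
      _ = (∑ j ∈ s.image Prod.fst, (1 / 2 : ℝ) ^ j) * (√L * 11) := by rw [Finset.sum_mul]
      _ ≤ 2 * (√L * 11) := by
          gcongr
          exact (summable_geometric_two.sum_le_tsum _ fun _ _ => by positivity).trans_eq
            tsum_geometric_two
      _ = 22 * √L := by ring
  refine ⟨a, hsum, ?_⟩
  have hS : Summable fun q => a q • windowExp L q.1 q.2 := by
    refine .of_norm ?_
    simp only [norm_smul, norm_windowExp, mul_one]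
    exact summable_of_sum_le (fun _ => norm_nonneg _) hsum
  set G : ℕ → L2Rplus := fun j =>
    Complex.exp (-z * (j * L : ℝ)) • windowLp L j (fourier (-m) * evenExp L l) with hGdef
  have hfib : ∀ j, HasSum (fun k => a (j, k) • windowExp L j k) (G j) := by
    intro j
    have h1 := ((windowLp L j).hasSum hfs).const_smul (Complex.exp (-z * (j * L : ℝ)))
    convert h1 using 2 with k
    simp only [map_smul, windowExp, smul_smul, ha]
    congr 1
    field_simp
  have hGae : ∀ j, G j =ᵐ[volume.restrict (Set.Ici (0 : ℝ))]
      (Set.Ico (j * L) ((j + 1) * L)).indicator fun t : ℝ => Complex.exp (-(z : ℂ) * t) := by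
    intro j
    filter_upwards [Lp.coeFn_smul (Complex.exp (-z * (j * L : ℝ)))
      (windowLp L j (fourier (-m) * evenExp L l)),
      coeFn_windowLp j (fourier (-m) * evenExp L l)] with t h1 h2
    rw [hGdef, h1, Pi.smul_apply, h2]
    by_cases ht : t ∈ Set.Ico (j * L) ((j + 1) * L)
    · have h3 : |t - j * L| = t - j * L := abs_of_nonneg (by linarith [ht.1])
      simp only [windowFun, Set.indicator_of_mem ht, ContinuousMap.mul_apply, smul_eq_mul]
      rw [evenExp_coe hL l (by rw [h3]; linarith [ht.2]), fourier_two_mul_coe hL, h3,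
        ← Complex.exp_add, ← Complex.exp_add]
      congr 1
      simp only [hl]
      push_cast
      ring
    · simp [windowFun, ht]
  -- The double series converges absolutely; summing it window by window identifies its limit as
  -- `expL2 z`.
  have h1 := (hS.hasSum.prod_fiberwise hfib).tendsto_sum_nat
  rw [← tendsto_nhds_unique h1 (tendsto_sum_range_expL2 hL z hGae)]
  exact hS.hasSum

end Expansion

/-! ### The `R`-bound of the Laplace transform -/

section LaplaceRBound

variable {E F : Type*} [NormedAddCommGroup E] [NormedSpace ℂ E] [CompleteSpace E]
  [NormedAddCommGroup F] [NormedSpace ℂ F] (Θ : F →L[ℂ] AlmostSumming L2Rplus E)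

/-- Even and odd frequencies form two orthonormal systems; their union costs the factor 2. -/
theorem isRBoundedWith_windowExp {L : ℝ} [Fact (0 < 2 * L)] :
    IsRBoundedWith (Set.range fun q : ℕ × ℤ =>
      (AlmostSumming.incl L2Rplus E ∘L Θ).flip (windowExp L q.1 q.2))
      (2 * (‖Θ‖ / gaussianAbsMoment)) := by
  refine ((isRBoundedWith_orthonormal Θ (orthonormal_windowExp (L := L) 0)).union
    (isRBoundedWith_orthonormal Θ (orthonormal_windowExp (L := L) 1))).mono ?_
  rintro _ ⟨⟨j, k⟩, rfl⟩
  rcases Int.even_or_odd' k with ⟨d, rfl | rfl⟩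
  · exact Or.inl ⟨(j, d), by simp⟩
  · exact Or.inr ⟨(j, d), rfl⟩

theorem isRBoundedWith_laplaceTransform {δ : ℝ} (hδ : 0 < δ) :
    IsRBoundedWith (laplaceTransform (AlmostSumming.incl L2Rplus E ∘L Θ) ''
      {z : RightHalfPlane | δ ≤ (z : ℂ).re})
      (‖Θ‖ * (88 * √Real.pi / gaussianAbsMoment / √δ)) := by
  have hpi := Real.pi_pos
  have hm := gaussianAbsMoment_pos
  -- With `L = π/δ` the condition `π/L ≤ Re z` is exactly `δ ≤ Re z`. The constant 88 is the
  -- coefficient bound 22, times 2 for complex coefficients, times 2 for the parities.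
  have hT : Fact (0 < 2 * (Real.pi / δ)) := ⟨by positivity⟩
  have h := (isRBoundedWith_windowExp Θ (L := Real.pi / δ)).of_hasSum (A := 22 * √(Real.pi / δ))
    (by positivity)
  have hC : 2 * (22 * √(Real.pi / δ) * (2 * (‖Θ‖ / gaussianAbsMoment)))
      = ‖Θ‖ * (88 * √Real.pi / gaussianAbsMoment / √δ) := by
    rw [Real.sqrt_div hpi.le]
    ring
  rw [hC] at h
  refine h.mono ?_
  rintro _ ⟨z, hz, rfl⟩
  obtain ⟨a, ha, hsum⟩ := exists_hasSum_windowExp (L := Real.pi / δ) z (by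
    rw [div_div_cancel₀ hpi.ne']; exact hz)
  refine ⟨a, ha, ?_⟩
  have h1 := (AlmostSumming.incl L2Rplus E ∘L Θ).flip.hasSum hsum
  simp only [map_smul] at h1
  exact h1

end LaplaceRBound

end

theorem theorem3p1 :
    ∃ C : ℝ, 0 < C ∧
      ∀ (E : Type*) [NormedAddCommGroup E] [NormedSpace ℂ E] [CompleteSpace E]
        (F : Type*) [NormedAddCommGroup F] [NormedSpace ℂ F] [CompleteSpace F]
        (Θ : F →L[ℂ] AlmostSumming L2Rplus E) (δ : ℝ), 0 < δ →
        IsRBounded (laplaceTransform (AlmostSumming.incl L2Rplus E ∘L Θ) ''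
          {z : RightHalfPlane | δ < (z : ℂ).re}) ∧
        IsRBounded (laplaceTransform (AlmostSumming.incl L2Rplus E ∘L Θ) ''
          {z : RightHalfPlane | δ ≤ (z : ℂ).re}) ∧
        rBound (laplaceTransform (AlmostSumming.incl L2Rplus E ∘L Θ) ''
          {z : RightHalfPlane | δ ≤ (z : ℂ).re}) ≤ ‖Θ‖ * (C / √δ) := by
  have hm := gaussianAbsMoment_pos
  refine ⟨88 * √Real.pi / gaussianAbsMoment, by positivity, ?_⟩
  intro E _ _ _ F _ _ _ Θ δ hδ
  have h := isRBoundedWith_laplaceTransform Θ hδ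
  have h0 : 0 ≤ ‖Θ‖ * (88 * √Real.pi / gaussianAbsMoment / √δ) := by positivity
  exact ⟨⟨_, h0, h.mono (Set.image_mono fun z hz => (show δ < (z : ℂ).re from hz).le)⟩, ⟨_, h0, h⟩,
    csInf_le ⟨0, fun C hC => hC.1⟩ ⟨h0, h⟩⟩
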